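/- Let $p\in\mathbb N$, let $\mathcal X\subset\mathbb R^p$ be open and contractible, and let $\varphi$ be a function of Legendre type on $\mathcal X$; that is, $\mathcal X$ is a nonempty open convex set, $\varphi:\mathcal X\to\mathbb R$ is strictly convex and differentiable, and $\|\nabla\varphi(z)\|_2\to\infty$ whenever $z\in\mathcal X$ tends to a boundary point of $\mathcal X$. Let $f,\varphi\in C^3(\mathcal X)$. Assume that $D^2\varphi(x)$ is invertible for every $x\in\mathcal X$ and that, for some $\delta\ge 0$, the commutator of the Hessians satisfies, in spectral norm, $$\bigl\|(D^2\varphi(x))^{-1}D^2f(x)-D^2f(x)(D^2\varphi(x))^{-1}\bigr\|_2\le\delta\qquad\text{for all }x\in\mathcal X .$$ Assume further that there are constants $0\le m\le M$ with $M>0$ such that for all $x_1,x_2\in\mathcal X$ $$m\|\nabla\varphi(x_1)-\nabla\varphi(x_2)\|_2^2\le\langle\nabla f(x_1)-\nabla f(x_2),\nabla\varphi(x_1)-\nabla\varphi(x_2)\rangle\le M\|\nabla\varphi(x_1)-\nabla\varphi(x_2)\|_2^2 .$$ Then for all $x_1,x_2\in\mathcal X$ $$\langle\nabla f(x_1)-\nabla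 f(x_2),\nabla\varphi(x_1)-\nabla\varphi(x_2)\rangle\ge\frac1{m+M}\|\nabla f(x_1)-\nabla f(x_2)\|_2^2+\frac{4mM-4M\delta-\delta^2}{4(m+M)}\|\nabla\varphi(x_1)-\nabla\varphi(x_2)\|_2^2 .$$ -/

import Mathlib

open scoped Topology

/-- The pair `(X, φ)` is a convex function of Legendre type on `ℝᵖ`: `X` is a nonempty open convex
set, `φ` is strictly convex and differentiable on `X`, and `‖∇φ(z)‖ → ∞` whenever `z ∈ X` tends to
a boundary point of `X` (convexity of `X` is part of `StrictConvexOn`). -/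
structure IsLegendreOn {p : ℕ} (X : Set (EuclideanSpace ℝ (Fin p)))
    (φ : EuclideanSpace ℝ (Fin p) → ℝ) : Prop where
  isOpen : IsOpen X
  nonempty : X.Nonempty
  strictConvexOn : StrictConvexOn ℝ X φ
  differentiableOn : DifferentiableOn ℝ φ X
  steep : ∀ x ∈ frontier X,
    Filter.Tendsto (fun z => ‖gradient φ z‖) (𝓝[X] x) Filter.atTop

/-- The Hessian `D²g(x)`, as the linear map on `ℝᵖ` given by the derivative of `∇g` at `x`. -/
noncomputable def hessian {p : ℕ} (g : EuclideanSpace ℝ (Fin p) → ℝ)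
    (x : EuclideanSpace ℝ (Fin p)) :
    EuclideanSpace ℝ (Fin p) →L[ℝ] EuclideanSpace ℝ (Fin p) :=
  fderiv ℝ (gradient g) x

/-- At every point of `X` the Hessian `D²φ(x)` is invertible, and the commutator
`(D²φ(x))⁻¹ D²f(x) - D²f(x) (D²φ(x))⁻¹` has spectral norm (that is, Euclidean operator norm)
at most `δ`. -/
def HessianCommutatorBound {p : ℕ} (X : Set (EuclideanSpace ℝ (Fin p)))
    (φ f : EuclideanSpace ℝ (Fin p) → ℝ) (δ : ℝ) : Prop :=
  ∀ x ∈ X, IsUnit (hessian φ x) ∧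
    ‖Ring.inverse (hessian φ x) * hessian f x - hessian f x * Ring.inverse (hessian φ x)‖ ≤ δ

/-! Work in the dual coordinate `y = ∇φ(x)`. There `∇f` becomes the map `∇f ∘ (∇φ)⁻¹`, whose
derivative is `J = D²f (D²φ)⁻¹`. Differentiating the two-sided hypothesis puts the quadratic form of
`J` between `m` and `M`. Since Hessians are symmetric, `J - Jᵀ` is minus the commutator, so its norm
is at most `δ`.

These conditions on an operator are closed and convex. Steepness makes `∇φ(X)` convex
(`segment_subset_image_gradient`), so integrating `J` along a segment gives `∇f(x₁) - ∇f(x₂) = A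
(∇φ(x₁) - ∇φ(x₂))` with `A` satisfying the same conditions.

The rest is linear algebra. For the symmetric part `S` of `A`, `(S - m)(M - S) ≥ 0` is the case `δ =
0`. The skew part has norm at most `δ / 2` and `‖S v‖ ≤ M ‖v‖`, so `‖A v‖²` exceeds `‖S v‖²` by at
most `(M δ + δ² / 4) ‖v‖²`. -/

section InnerProductSpace

/-! ### Operator inequalities. -/

variable {E : Type*} [NormedAddCommGroup E] [InnerProductSpace ℝ E]

/-- A symmetric operator `S` with `m ≤ S ≤ M` satisfies `(S - m) (M - S) ≥ 0`. -/
theorem LinearMap.IsSymmetric.norm_sq_add_le_mul_inner {S : E →ₗ[ℝ] E} (hS : S.IsSymmetric)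
    {m M : ℝ} (hmM : m ≤ M) (hl : ∀ v, m * ‖v‖ ^ 2 ≤ inner ℝ (S v) v)
    (hu : ∀ v, inner ℝ (S v) v ≤ M * ‖v‖ ^ 2) (v : E) :
    ‖S v‖ ^ 2 + m * M * ‖v‖ ^ 2 ≤ (m + M) * inner ℝ (S v) v := by
  set w := S v - m • v with hw
  have hww : ‖w‖ ^ 2 = ‖S v‖ ^ 2 - 2 * m * inner ℝ (S v) v + m ^ 2 * ‖v‖ ^ 2 := by
    rw [hw, norm_sub_sq_real, norm_smul, inner_smul_right, mul_pow, Real.norm_eq_abs, sq_abs]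
    ring
  have hwv : inner ℝ w v = inner ℝ (S v) v - m * ‖v‖ ^ 2 := by
    rw [hw, inner_sub_left, inner_smul_left, real_inner_self_eq_norm_sq]; simp
  have hSwv : inner ℝ (S w) v - m * inner ℝ w v = ‖w‖ ^ 2 := by
    rw [hS w v, ← real_inner_self_eq_norm_sq, ← inner_smul_right, ← inner_sub_right]
  -- Positivity of `S - m` at `v - a • w`, with `⟨S w, w⟩` bounded by `M ‖w‖²`; this is the proof of
  -- Cauchy–Schwarz for the form of `S - m`. The optimal `a` is `(M - m)⁻¹`; if `m = M`, then `a =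
  -- 1` already forces `w = 0`.
  have key : ∀ a : ℝ, 0 ≤ (inner ℝ (S v) v - m * ‖v‖ ^ 2) - 2 * a * ‖w‖ ^ 2
      + a ^ 2 * ((M - m) * ‖w‖ ^ 2) := by
    intro a
    have h1 := hl (v - a • w)
    have h2 := hu w
    have e1 : inner ℝ (S (v - a • w)) (v - a • w) = inner ℝ (S v) v - 2 * a * inner ℝ (S w) v
        + a ^ 2 * inner ℝ (S w) w := by
      have : inner ℝ (S v) w = inner ℝ (S w) v := by rw [hS v w, real_inner_comm]
      simp only [map_sub, map_smul, inner_sub_left, inner_sub_right, inner_smul_left,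
        inner_smul_right, this, conj_trivial]
      ring
    have e2 : ‖v - a • w‖ ^ 2 = ‖v‖ ^ 2 - 2 * a * inner ℝ w v + a ^ 2 * ‖w‖ ^ 2 := by
      rw [norm_sub_sq_real, norm_smul, inner_smul_right, mul_pow, Real.norm_eq_abs, sq_abs,
        real_inner_comm]
      ring
    rw [e1, e2] at h1
    have h3 := mul_le_mul_of_nonneg_left h2 (sq_nonneg a)
    linear_combination h1 + h3 - 2 * a * hSwv
  suffices ‖w‖ ^ 2 ≤ (M - m) * (inner ℝ (S v) v - m * ‖v‖ ^ 2) by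
    rw [hww] at this; linarith
  rcases hmM.eq_or_lt with h | h
  · have h0 : inner ℝ (S v) v - m * ‖v‖ ^ 2 = 0 := by
      have := hl v; have := hu v; rw [← h] at this; linarith
    have := key 1
    rw [h0, ← h] at this
    rw [← h]; linarith
  · have hL : 0 < M - m := sub_pos.2 h
    have := mul_nonneg hL.le (key (M - m)⁻¹)
    have e : (M - m) * ((inner ℝ (S v) v - m * ‖v‖ ^ 2) - 2 * (M - m)⁻¹ * ‖w‖ ^ 2
      + (M - m)⁻¹ ^ 2 * ((M - m) * ‖w‖ ^ 2)) =
        (M - m) * (inner ℝ (S v) v - m * ‖v‖ ^ 2) - ‖w‖ ^ 2 := by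
      field_simp; ring
    linarith

/-- The bound of `LinearMap.IsSymmetric.norm_sq_add_le_mul_inner` for an operator whose
antisymmetric part has norm at most `δ / 2`. -/
theorem ContinuousLinearMap.norm_sq_add_le_mul_inner_of_skew_le [CompleteSpace E] (A : E →L[ℝ] E)
    {m M δ : ℝ} (hm : 0 ≤ m) (hmM : m ≤ M) (hδ : 0 ≤ δ)
    (hl : ∀ v, m * ‖v‖ ^ 2 ≤ inner ℝ (A v) v) (hu : ∀ v, inner ℝ (A v) v ≤ M * ‖v‖ ^ 2)
    (hA : ∀ u v, inner ℝ (A u) v - inner ℝ (A v) u ≤ δ * (‖u‖ * ‖v‖)) (v : E) :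
    ‖A v‖ ^ 2 + (m * M - M * δ - δ ^ 2 / 4) * ‖v‖ ^ 2 ≤ (m + M) * inner ℝ (A v) v := by
  set S : E →ₗ[ℝ] E := ((1 / 2 : ℝ) • (A + ContinuousLinearMap.adjoint A)).toLinearMap with hSdef
  have hSi : ∀ x y, inner ℝ (S x) y = (inner ℝ (A x) y + inner ℝ (A y) x) / 2 := by
    intro x y
    simp only [hSdef, ContinuousLinearMap.coe_coe, smul_apply,
      add_apply, inner_smul_left, inner_add_left,
      ContinuousLinearMap.adjoint_inner_left, conj_trivial, real_inner_comm x (A y)]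
    ring
  have hS : S.IsSymmetric := by
    intro x y
    rw [real_inner_comm (S y), hSi, hSi, add_comm]
  have hSA : ∀ x, inner ℝ (S x) x = inner ℝ (A x) x := by intro x; rw [hSi]; ring
  have h1 := hS.norm_sq_add_le_mul_inner hmM (fun x => (hSA x).symm ▸ hl x)
    (fun x => (hSA x).symm ▸ hu x) v
  rw [hSA] at h1
  have hv := norm_nonneg v
  -- `A - S` is skew; its value `w` at `v` is estimated by testing `hA` on the pair `v`, `w`.
  have h2 : ‖A v - S v‖ ≤ δ / 2 * ‖v‖ := by
    set w := A v - S v with hw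
    have : ‖w‖ ^ 2 ≤ (δ / 2 * ‖v‖) * ‖w‖ := by
      have e : ‖w‖ ^ 2 = (inner ℝ (A v) w - inner ℝ (A w) v) / 2 := by
        rw [← real_inner_self_eq_norm_sq]
        nth_rw 1 [hw]
        rw [inner_sub_left, hSi]; ring
      have := hA v w
      rw [e]; linarith
    rcases (norm_nonneg w).eq_or_lt with h | h
    · rw [← h]; positivity
    · rw [sq] at this
      exact le_of_mul_le_mul_right this h
  -- By Cauchy–Schwarz, `h1` gives `(‖S v‖ - m ‖v‖)(‖S v‖ - M ‖v‖) ≤ 0`.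
  have h3 : ‖S v‖ ≤ M * ‖v‖ := by
    by_contra! h
    have hc := mul_le_mul_of_nonneg_left (real_inner_le_norm (S v) v) (add_nonneg hm (hm.trans hmM))
    rw [hSA] at hc
    have hpos : 0 < (‖S v‖ - m * ‖v‖) * (‖S v‖ - M * ‖v‖) :=
      mul_pos (by nlinarith) (by linarith)
    nlinarith
  have h4 : ‖A v‖ ≤ ‖S v‖ + δ / 2 * ‖v‖ := by
    calc ‖A v‖ = ‖S v + (A v - S v)‖ := by simp
      _ ≤ _ := (norm_add_le _ _).trans (by gcongr)
  have h5 : ‖A v‖ ^ 2 ≤ (‖S v‖ + δ / 2 * ‖v‖) ^ 2 := by gcongr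
  have h6 : ‖S v‖ * (δ * ‖v‖) ≤ M * ‖v‖ * (δ * ‖v‖) := by gcongr
  linarith

/-! ### Gradient inequalities and Bregman divergences. -/

section Convex

variable [CompleteSpace E] {X : Set E} {f : E → ℝ}

theorem ConvexOn.add_inner_gradient_le (hf : ConvexOn ℝ X f) {x z g : E} (hx : x ∈ X) (hz : z ∈ X)
    (hg : HasGradientAt f g x) : f x + inner ℝ g (z - x) ≤ f z := by
  have hline : HasDerivAt (f ∘ AffineMap.lineMap (k := ℝ) x z) (inner ℝ g (z - x)) 0 := by
    have h1 : HasDerivAt (fun s : ℝ => AffineMap.lineMap x z s) (z - x) 0 :=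
      AffineMap.hasDerivAt_lineMap
    have h2 : HasFDerivAt f (InnerProductSpace.toDual ℝ E g) (AffineMap.lineMap x z (0 : ℝ)) := by
      simpa using hg.hasFDerivAt
    have h3 := h2.comp_hasDerivAt _ h1
    rwa [InnerProductSpace.toDual_apply_apply] at h3
  have hc := hf.comp_affineMap (AffineMap.lineMap (k := ℝ) x z)
  have := hc.le_slope_of_hasDerivAt (x := 0) (y := 1) (by simpa) (by simpa) one_pos hline
  simp [slope_def_field] at this
  linarith

theorem StrictConvexOn.add_inner_gradient_lt (hf : StrictConvexOn ℝ X f) {x z g : E} (hx : x ∈ X)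
    (hz : z ∈ X) (hxz : x ≠ z) (hg : HasGradientAt f g x) : f x + inner ℝ g (z - x) < f z := by
  have hmid := hf.2 hx hz hxz (one_half_pos (α := ℝ)) one_half_pos (by norm_num)
  have hw := hf.1 hx hz (one_half_pos (α := ℝ)).le one_half_pos.le (by norm_num)
  have h := hf.convexOn.add_inner_gradient_le hx hw hg
  have e : (1 / 2 : ℝ) • x + (1 / 2 : ℝ) • z - x = (1 / 2 : ℝ) • (z - x) := by module
  rw [e, inner_smul_right] at h
  simp only [smul_eq_mul] at hmid
  linarith

/-- The Bregman divergence from a fixed interior point has bounded sublevel sets. -/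
theorem StrictConvexOn.exists_norm_sub_le_of_bregman_le [FiniteDimensional ℝ E]
    (hf : StrictConvexOn ℝ X f) (hX : IsOpen X) (hfc : ContinuousOn f X) {x₀ g : E} (hx₀ : x₀ ∈ X)
    (hg : HasGradientAt f g x₀) (C : ℝ) :
    ∃ R, ∀ x ∈ X, f x - f x₀ - inner ℝ g (x - x₀) ≤ C → ‖x - x₀‖ ≤ R := by
  obtain ⟨r, hr, hball⟩ := Metric.nhds_basis_closedBall.mem_iff.1 (hX.mem_nhds hx₀)
  have hsph : Metric.sphere x₀ r ⊆ X := Metric.sphere_subset_closedBall.trans hball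
  have hcont : ContinuousOn (fun x => f x - f x₀ - inner ℝ g (x - x₀)) (Metric.sphere x₀ r) := by
    have := hfc.mono hsph
    fun_prop
  obtain ⟨ε, hε, hεle⟩ := (isCompact_sphere x₀ r).exists_forall_le' hcont (a := 0) (by
    intro x hx
    have hne : x₀ ≠ x := by
      rintro rfl; simp at hx; exact hr.ne hx
    have := hf.add_inner_gradient_lt hx₀ (hsph hx) hne hg
    linarith)
  -- The divergence is at least `ε` on the sphere of radius `r` and vanishes at `x₀`, so by
  -- convexity it is at least `ε d / r` at distance `d ≥ r`.
  refine ⟨max r (r * C / ε), fun x hx hxC => ?_⟩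
  by_contra! hd
  obtain ⟨hd1, hd2⟩ := max_lt_iff.1 hd
  set d := ‖x - x₀‖
  have hdpos : 0 < d := hr.trans hd1
  set t := r / d
  have ht0 : 0 < t := div_pos hr hdpos
  have ht1 : t ≤ 1 := (div_le_one hdpos).2 hd1.le
  have hw : (1 - t) • x₀ + t • x = x₀ + t • (x - x₀) := by module
  have hws : (1 - t) • x₀ + t • x ∈ Metric.sphere x₀ r := by
    rw [hw, mem_sphere_iff_norm, add_sub_cancel_left, norm_smul, Real.norm_of_nonneg ht0.le]
    exact div_mul_cancel₀ _ hdpos.ne'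
  have h1 := hεle _ hws
  have h2 := hf.convexOn.2 hx₀ hx (sub_nonneg.2 ht1) ht0.le (by ring)
  have e : (1 - t) • x₀ + t • x - x₀ = t • (x - x₀) := by module
  simp only [smul_eq_mul] at h2
  rw [e, inner_smul_right] at h1
  have h3 : ε ≤ t * C := by
    have := mul_le_mul_of_nonneg_left hxC ht0.le
    linarith
  have h4 : t * C = r * C / d := by simp only [t]; ring
  rw [h4, le_div_iff₀ hdpos] at h3
  rw [div_lt_iff₀ hε] at hd2
  linarith

end Convex

end InnerProductSpace

/-! ### Averaging the derivative. -/

/-- A mean value theorem: if `F' t = J t v` with `J` continuous with values in a closed convex set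
of operators, then `F 1 - F 0 = A v` for some `A` in this set. -/
theorem exists_mem_sub_eq_apply_of_hasDerivAt {E F : Type*} [NormedAddCommGroup E]
    [NormedSpace ℝ E] [NormedAddCommGroup F] [NormedSpace ℝ F] [CompleteSpace F]
    {s : Set (E →L[ℝ] F)} (hs : Convex ℝ s) (hsc : IsClosed s) {J : ℝ → E →L[ℝ] F}
    (hJ : ContinuousOn J (Set.Icc 0 1)) (hJs : ∀ t ∈ Set.Icc (0 : ℝ) 1, J t ∈ s) {v : E} {g : ℝ → F}
    (hg : ∀ t ∈ Set.Icc (0 : ℝ) 1, HasDerivAt g (J t v) t) :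
    ∃ A ∈ s, g 1 - g 0 = A v := by
  have hint : IntervalIntegrable J MeasureTheory.volume 0 1 :=
    ContinuousOn.intervalIntegrable (by rwa [Set.uIcc_of_le zero_le_one])
  have hint' := (intervalIntegrable_iff_integrableOn_Ioc_of_le zero_le_one).1 hint
  refine ⟨∫ t in (0 : ℝ)..1, J t, ?_, ?_⟩
  · rw [intervalIntegral.integral_of_le zero_le_one]
    have : MeasureTheory.IsProbabilityMeasure
        (MeasureTheory.volume.restrict (Set.Ioc (0 : ℝ) 1)) := ⟨by simp⟩
    refine hs.integral_mem hsc ?_ hint'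
    exact (MeasureTheory.ae_restrict_mem measurableSet_Ioc).mono
      fun t ht => hJs t (Set.Ioc_subset_Icc_self ht)
  · rw [ContinuousLinearMap.intervalIntegral_apply hint,
      intervalIntegral.integral_eq_sub_of_hasDerivAt]
    · rwa [Set.uIcc_of_le zero_le_one]
    · refine ContinuousOn.intervalIntegrable ?_
      rw [Set.uIcc_of_le zero_le_one]
      exact hJ.clm_apply continuousOn_const

/-! ### Gradients and Hessians. -/

section Gradient

variable {p : ℕ} {X : Set (EuclideanSpace ℝ (Fin p))} {g φ f : EuclideanSpace ℝ (Fin p) → ℝ}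
  {x : EuclideanSpace ℝ (Fin p)}

theorem ContDiffAt.gradient {n k : WithTop ℕ∞} (hg : ContDiffAt ℝ n g x) (hk : k + 1 ≤ n) :
    ContDiffAt ℝ k (_root_.gradient g) x :=
  (InnerProductSpace.toDual ℝ _).symm.toContinuousLinearEquiv.contDiff.contDiffAt.comp x
    (hg.fderiv_right hk)

theorem ContDiffAt.hasStrictFDerivAt_gradient (hg : ContDiffAt ℝ 2 g x) :
    HasStrictFDerivAt (_root_.gradient g) (hessian g x) x :=
  (hg.gradient (k := 1) (by norm_num)).hasStrictFDerivAt one_ne_zero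

theorem ContDiffAt.continuousAt_hessian (hg : ContDiffAt ℝ 2 g x) :
    ContinuousAt (hessian g) x :=
  ((hg.gradient (k := 1) (by norm_num)).fderiv_right (m := 0) (by norm_num)).continuousAt

theorem inner_hessian_comm (hg : ContDiffAt ℝ 2 g x) (u v : EuclideanSpace ℝ (Fin p)) :
    inner ℝ (hessian g x u) v = inner ℝ (hessian g x v) u := by
  have h : ∀ u v, inner ℝ (hessian g x u) v = fderiv ℝ (fderiv ℝ g) x u v := by
    intro u v
    have hd : DifferentiableAt ℝ (fderiv ℝ g) x :=
      (hg.fderiv_right (m := 1) (by norm_num)).differentiableAt one_ne_zero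
    have := ((InnerProductSpace.toDual ℝ (EuclideanSpace ℝ (Fin p))).symm.toContinuousLinearEquiv
      |>.hasFDerivAt.comp x hd.hasFDerivAt).fderiv
    have e : hessian g x u
        = (InnerProductSpace.toDual ℝ (EuclideanSpace ℝ (Fin p))).symm
            (fderiv ℝ (fderiv ℝ g) x u) :=
      congrArg (fun L => L u) this
    rw [e, InnerProductSpace.toDual_symm_apply]
  rw [h, h]
  exact hg.isSymmSndFDerivAt (by simp) u v

/-- If the increments of `∇f` and `∇φ` satisfy a closed quadratic relation, then so do the
Hessians. -/
theorem inner_hessian_le_of_inner_gradient_le (hX : IsOpen X) (hx : x ∈ X)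
    (hφ : HasFDerivAt (gradient φ) (hessian φ x) x) (hf : HasFDerivAt (gradient f) (hessian f x) x)
    {a b : ℝ} (h : ∀ x₁ ∈ X, ∀ x₂ ∈ X,
      0 ≤ a * inner ℝ (gradient f x₁ - gradient f x₂) (gradient φ x₁ - gradient φ x₂)
        + b * ‖gradient φ x₁ - gradient φ x₂‖ ^ 2) (w : EuclideanSpace ℝ (Fin p)) :
    0 ≤ a * inner ℝ (hessian f x w) (hessian φ x w) + b * ‖hessian φ x w‖ ^ 2 := by
  have hline : HasDerivAt (fun t : ℝ => x + t • w) w 0 := by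
    simpa using ((hasDerivAt_id (0 : ℝ)).smul_const w).const_add x
  have hslope : ∀ k : EuclideanSpace ℝ (Fin p) → ℝ, HasFDerivAt (gradient k) (hessian k x) x →
      Filter.Tendsto (fun t : ℝ => t⁻¹ • (gradient k (x + t • w) - gradient k x)) (𝓝[≠] 0)
        (𝓝 (hessian k x w)) := by
    intro k hk
    have hk' : HasFDerivAt (gradient k) (hessian k x) (x + (0 : ℝ) • w) := by simpa using hk
    simpa using (hk'.comp_hasDerivAt 0 hline).tendsto_slope_zero
  have h1 := hslope f hf
  have h2 := hslope φ hφ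
  have hmem : ∀ᶠ t : ℝ in 𝓝[≠] 0, x + t • w ∈ X := by
    apply hline.continuousAt.continuousWithinAt.eventually_mem
    simpa using hX.mem_nhds hx
  -- The hypothesis for the pair `x + t • w`, `x`, divided by `t²`, as `t → 0`.
  refine ge_of_tendsto (((h1.inner h2).const_mul a).add ((h2.norm.pow 2).const_mul b)) ?_
  filter_upwards [hmem] with t ht
  have := mul_nonneg (sq_nonneg t⁻¹) (h _ ht x hx)
  rw [inner_smul_left, inner_smul_right, norm_smul, mul_pow, Real.norm_eq_abs, sq_abs, conj_trivial]
  linarith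

/-! ### The gradient image of a Legendre function. -/

namespace IsLegendreOn

theorem hasGradientAt (h : IsLegendreOn X φ) (hx : x ∈ X) : HasGradientAt φ (gradient φ x) x :=
  (h.differentiableOn.differentiableAt (h.isOpen.mem_nhds hx)).hasGradientAt

theorem injOn_gradient (h : IsLegendreOn X φ) : Set.InjOn (gradient φ) X := by
  intro a ha b hb hab
  by_contra hne
  have h1 := h.strictConvexOn.add_inner_gradient_lt ha hb hne (h.hasGradientAt ha)
  have h2 := h.strictConvexOn.add_inner_gradient_lt hb ha (Ne.symm hne) (h.hasGradientAt hb)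
  rw [hab, ← neg_sub a b, inner_neg_right] at h1
  linarith

/-- Points whose gradients lie on a segment between two values of the gradient stay bounded. -/
theorem exists_norm_le_of_gradient_mem_segment (h : IsLegendreOn X φ)
    {a b : EuclideanSpace ℝ (Fin p)} (ha : a ∈ X) (hb : b ∈ X) :
    ∃ R, ∀ x ∈ X, gradient φ x ∈ segment ℝ (gradient φ a) (gradient φ b) → ‖x‖ ≤ R := by
  set C := |φ a - φ b - inner ℝ (gradient φ b) (a - b)|
  obtain ⟨R₁, hR₁⟩ := h.strictConvexOn.exists_norm_sub_le_of_bregman_le h.isOpen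
    h.differentiableOn.continuousOn ha (h.hasGradientAt ha) C
  obtain ⟨R₂, hR₂⟩ := h.strictConvexOn.exists_norm_sub_le_of_bregman_le h.isOpen
    h.differentiableOn.continuousOn hb (h.hasGradientAt hb) C
  refine ⟨max (R₁ + ‖a‖) (R₂ + ‖b‖), fun x hx hseg => ?_⟩
  -- Write `D_c` for the divergence from `c` and `∇φ(x) = s ∇φ(a) + t ∇φ(b)`. The gradient
  -- inequality at `x` yields `s D_a(x) + t D_b(x) ≤ t D_b(a) ≤ t C`, so `D_a(x)` and `D_b(x)`
  -- cannot both exceed `C`.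
  have hor : φ x - φ a - inner ℝ (gradient φ a) (x - a) ≤ C ∨
      φ x - φ b - inner ℝ (gradient φ b) (x - b) ≤ C := by
    by_contra! hcon
    obtain ⟨s, t, hs, ht, hst, hy⟩ := hseg
    have h1 := h.strictConvexOn.convexOn.add_inner_gradient_le hx ha (h.hasGradientAt hx)
    rw [← hy, inner_add_left, inner_smul_left, inner_smul_left, conj_trivial, conj_trivial,
      ← neg_sub x a, inner_neg_right, inner_neg_right] at h1
    have h2 : s * C + t * C ≤ s * (φ x - φ a - inner ℝ (gradient φ a) (x - a))
        + t * (φ x - φ b - inner ℝ (gradient φ b) (x - b)) :=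
      add_le_add (mul_le_mul_of_nonneg_left hcon.1.le hs) (mul_le_mul_of_nonneg_left hcon.2.le ht)
    have e : inner ℝ (gradient φ b) (x - b)
        = inner ℝ (gradient φ b) (x - a) + inner ℝ (gradient φ b) (a - b) := by
      rw [← inner_add_right, sub_add_sub_cancel]
    have hC : C = s * C + t * C := by rw [← add_mul, hst, one_mul]
    have h3 : t * (φ a - φ b - inner ℝ (gradient φ b) (a - b)) ≤ t * C :=
      mul_le_mul_of_nonneg_left (le_abs_self _) ht
    have hC0 : 0 ≤ C := abs_nonneg _
    have hs1 : s = 1 - t := by linarith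
    subst hs1
    rw [e] at h2
    rcases ht.eq_or_lt with rfl | ht'
    · simp at h1 h2 hcon
      linarith
    · have h4 : (1 - t) * C + t * C < (1 - t) * (φ x - φ a - inner ℝ (gradient φ a) (x - a))
        + t * (φ x - φ b - inner ℝ (gradient φ b) (x - b)) :=
        add_lt_add_of_le_of_lt (mul_le_mul_of_nonneg_left hcon.1.le hs)
          (mul_lt_mul_of_pos_left hcon.2 ht')
      rw [e] at h4
      have h5 : 0 ≤ (1 - t) * C := mul_nonneg hs hC0
      linarith
  rcases hor with h1 | h1
  · refine le_max_of_le_left ?_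
    linarith [hR₁ x hx h1, norm_sub_norm_le x a]
  · refine le_max_of_le_right ?_
    linarith [hR₂ x hx h1, norm_sub_norm_le x b]

/-- The image of the gradient of a Legendre function is convex, if it is open. -/
theorem segment_subset_image_gradient (h : IsLegendreOn X φ) (hc : ContinuousOn (gradient φ) X)
    (ho : IsOpen (gradient φ '' X)) {a b : EuclideanSpace ℝ (Fin p)} (ha : a ∈ X) (hb : b ∈ X) :
    ∀ t ∈ Set.Icc (0 : ℝ) 1,
      AffineMap.lineMap (gradient φ a) (gradient φ b) t ∈ gradient φ '' X := by
  set y : ℝ → EuclideanSpace ℝ (Fin p) := fun t => AffineMap.lineMap (gradient φ a) (gradient φ b) t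
  have hy : Continuous y := AffineMap.lineMap_continuous
  suffices Set.Icc (0 : ℝ) 1 ⊆ y ⁻¹' (gradient φ '' X) from this
  -- Continuity method: the good parameters contain `0`, form a closed set by compactness and
  -- steepness, and an open condition by `ho`.
  refine IsClosed.Icc_subset_of_forall_mem_nhdsWithin ?_ ?_ ?_
  · refine IsSeqClosed.isClosed fun t t₀ ht hlim => ?_
    have ht₀ : t₀ ∈ Set.Icc (0 : ℝ) 1 := isClosed_Icc.mem_of_tendsto hlim
      (Filter.Eventually.of_forall fun n => (ht n).2)
    refine ⟨?_, ht₀⟩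
    choose x hxX hxy using fun n => (ht n).1
    obtain ⟨R, hR⟩ := h.exists_norm_le_of_gradient_mem_segment ha hb
    have hbd : ∀ n, x n ∈ Metric.closedBall (0 : EuclideanSpace ℝ (Fin p)) R := fun n => by
      rw [mem_closedBall_zero_iff]
      refine hR _ (hxX n) ?_
      rw [hxy, segment_eq_image_lineMap]
      exact Set.mem_image_of_mem _ (ht n).2
    obtain ⟨z, -, k, hk, hz⟩ := (isCompact_closedBall _ R).tendsto_subseq hbd
    have hgr : Filter.Tendsto (fun n => gradient φ (x (k n))) Filter.atTop (𝓝 (y t₀)) := by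
      simp only [hxy]
      exact (hy.tendsto t₀).comp (hlim.comp hk.tendsto_atTop)
    have hzw : Filter.Tendsto (x ∘ k) Filter.atTop (𝓝[X] z) :=
      tendsto_nhdsWithin_iff.2 ⟨hz, Filter.Eventually.of_forall fun n => hxX _⟩
    -- At a boundary point steepness would make the gradients blow up, whereas they converge to `y
    -- t₀`.
    have hzX : z ∈ X := by
      by_contra hzX
      have hfr : z ∈ frontier X := by
        rw [h.isOpen.frontier_eq]
        exact ⟨mem_closure_of_tendsto hz (Filter.Eventually.of_forall fun n => hxX _), hzX⟩
      exact not_tendsto_nhds_of_tendsto_atTop ((h.steep z hfr).comp hzw) _ hgr.norm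
    exact ⟨z, hzX, tendsto_nhds_unique ((hc z hzX).tendsto.comp hzw) hgr⟩
  · simpa [y] using Set.mem_image_of_mem (gradient φ) ha
  · intro t ht
    exact mem_nhdsWithin_of_mem_nhds (hy.continuousAt.preimage_mem_nhds (ho.mem_nhds ht.1))

end IsLegendreOn

/-! ### Inverting the gradient. -/

/-- The image of `∇φ` is open if its derivative is invertible on the open set `X`. -/
theorem isOpen_image_gradient (hφ : ∀ x ∈ X, HasStrictFDerivAt (gradient φ) (hessian φ x) x)
    (hu : ∀ x ∈ X, IsUnit (hessian φ x)) {U : Set (EuclideanSpace ℝ (Fin p))} (hU : IsOpen U)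
    (hUX : U ⊆ X) : IsOpen (gradient φ '' U) := by
  rw [isOpen_iff_mem_nhds]
  rintro _ ⟨x, hx, rfl⟩
  obtain ⟨u, hu'⟩ := hu x (hUX hx)
  have h : HasStrictFDerivAt (gradient φ) (ContinuousLinearEquiv.unitsEquiv ℝ _ u :
      EuclideanSpace ℝ (Fin p) →L[ℝ] EuclideanSpace ℝ (Fin p)) x := by
    convert hφ x (hUX hx)
    exact hu'
  rw [← h.map_nhds_eq_of_equiv]
  exact Filter.image_mem_map (hU.mem_nhds hx)

/-- The inverse of an injective gradient with invertible derivative is differentiable. -/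
theorem hasFDerivAt_invFunOn_gradient (hX : IsOpen X) (hinj : Set.InjOn (gradient φ) X)
    (hφ : ∀ x ∈ X, HasStrictFDerivAt (gradient φ) (hessian φ x) x)
    (hu : ∀ x ∈ X, IsUnit (hessian φ x)) (hx : x ∈ X) :
    HasFDerivAt (Function.invFunOn (gradient φ) X) (Ring.inverse (hessian φ x)) (gradient φ x) := by
  have hleft : Set.LeftInvOn (Function.invFunOn (gradient φ) X) (gradient φ) X :=
    hinj.leftInvOn_invFunOn
  -- Continuity of the inverse comes from openness of `∇φ` on small neighbourhoods `U` of `x`.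
  have hcont : ContinuousAt (Function.invFunOn (gradient φ) X) (gradient φ x) := by
    intro V hV
    rw [hleft hx] at hV
    obtain ⟨U, hUV, hU, hxU⟩ := mem_nhds_iff.1 (Filter.inter_mem hV (hX.mem_nhds hx))
    rw [Filter.mem_map]
    refine Filter.mem_of_superset
      ((isOpen_image_gradient hφ hu hU fun z hz => (hUV hz).2).mem_nhds
        (Set.mem_image_of_mem _ hxU)) ?_
    rintro _ ⟨z, hz, rfl⟩
    rw [Set.mem_preimage, hleft (hUV hz).2]
    exact (hUV hz).1
  obtain ⟨u, hu'⟩ := hu x hx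
  have h : HasFDerivAt (gradient φ) (ContinuousLinearEquiv.unitsEquiv ℝ _ u :
      EuclideanSpace ℝ (Fin p) →L[ℝ] EuclideanSpace ℝ (Fin p))
      (Function.invFunOn (gradient φ) X (gradient φ x)) := by
    rw [hleft hx]
    convert (hφ x hx).hasFDerivAt
    exact hu'
  have hinv := h.of_local_left_inverse hcont (by
    filter_upwards [(isOpen_image_gradient hφ hu hX subset_rfl).mem_nhds
      (Set.mem_image_of_mem _ hx)] with y hy
    exact Function.invFunOn_eq hy)
  rw [← hu', Ring.inverse_unit]
  exact hinv

end Gradient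

/-! ### The closed convex set containing the Jacobians. -/

/-- The operators with quadratic form between `m` and `M` and commutator with the adjoint at most
`δ`. -/
def quadraticBoundSet (E : Type*) [NormedAddCommGroup E] [InnerProductSpace ℝ E] (m M δ : ℝ) :
    Set (E →L[ℝ] E) :=
  {A | (∀ v, m * ‖v‖ ^ 2 ≤ inner ℝ (A v) v) ∧ (∀ v, inner ℝ (A v) v ≤ M * ‖v‖ ^ 2) ∧
    ∀ u v, inner ℝ (A u) v - inner ℝ (A v) u ≤ δ * (‖u‖ * ‖v‖)}

/-- For fixed vectors each condition is an affine inequality in the operator, so the set is an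
intersection of half-spaces. -/
theorem convex_quadraticBoundSet (E : Type*) [NormedAddCommGroup E] [InnerProductSpace ℝ E]
    (m M δ : ℝ) : Convex ℝ (quadraticBoundSet E m M δ) := by
  rintro A ⟨hA1, hA2, hA3⟩ B ⟨hB1, hB2, hB3⟩ a b ha hb hab
  have e : ∀ u v, inner ℝ ((a • A + b • B) u) v = a * inner ℝ (A u) v + b * inner ℝ (B u) v := by
    intro u v
    simp [inner_add_left, inner_smul_left]
  have hc : ∀ c : ℝ, c = a * c + b * c := fun c => by rw [← add_mul, hab, one_mul]
  refine ⟨fun v => ?_, fun v => ?_, fun u v => ?_⟩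
  · rw [e, hc (m * _)]
    exact add_le_add (mul_le_mul_of_nonneg_left (hA1 v) ha) (mul_le_mul_of_nonneg_left (hB1 v) hb)
  · rw [e, hc (M * _)]
    exact add_le_add (mul_le_mul_of_nonneg_left (hA2 v) ha) (mul_le_mul_of_nonneg_left (hB2 v) hb)
  · rw [e, e, hc (δ * _)]
    have := add_le_add (mul_le_mul_of_nonneg_left (hA3 u v) ha)
      (mul_le_mul_of_nonneg_left (hB3 u v) hb)
    linarith

theorem isClosed_quadraticBoundSet (E : Type*) [NormedAddCommGroup E] [InnerProductSpace ℝ E]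
    (m M δ : ℝ) : IsClosed (quadraticBoundSet E m M δ) := by
  simp only [quadraticBoundSet, Set.ofPred_and, Set.ofPred_forall]
  refine .inter ?_ (.inter ?_ ?_)
  · exact isClosed_iInter fun v => isClosed_le (by fun_prop) (by fun_prop)
  · exact isClosed_iInter fun v => isClosed_le (by fun_prop) (by fun_prop)
  · exact isClosed_iInter fun u => isClosed_iInter fun v => isClosed_le (by fun_prop) (by fun_prop)

/-- The form bounds are the differentiated hypotheses at `w = (D²φ)⁻¹ v`, where `D²φ w = v`. For the
skew bound, the adjoint of `D²f (D²φ)⁻¹` is `(D²φ)⁻¹ D²f`. -/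
theorem hessian_mul_inverse_mem_quadraticBoundSet {p : ℕ} {X : Set (EuclideanSpace ℝ (Fin p))}
    (hX : IsOpen X) {φ f : EuclideanSpace ℝ (Fin p) → ℝ} {m M δ : ℝ}
    (hcomm : HessianCommutatorBound X φ f δ)
    (hlower : ∀ x₁ ∈ X, ∀ x₂ ∈ X,
      m * ‖gradient φ x₁ - gradient φ x₂‖ ^ 2 ≤
        inner ℝ (gradient f x₁ - gradient f x₂) (gradient φ x₁ - gradient φ x₂))
    (hupper : ∀ x₁ ∈ X, ∀ x₂ ∈ X,
      inner ℝ (gradient f x₁ - gradient f x₂) (gradient φ x₁ - gradient φ x₂) ≤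
        M * ‖gradient φ x₁ - gradient φ x₂‖ ^ 2)
    {x : EuclideanSpace ℝ (Fin p)} (hx : x ∈ X) (hφ : ContDiffAt ℝ 2 φ x)
    (hf : ContDiffAt ℝ 2 f x) :
    hessian f x * Ring.inverse (hessian φ x) ∈ quadraticBoundSet (EuclideanSpace ℝ (Fin p)) m M δ := by
  obtain ⟨hu, hδ⟩ := hcomm x hx
  have hinv : ∀ v, hessian φ x (Ring.inverse (hessian φ x) v) = v := fun v =>
    congrArg (fun L : EuclideanSpace ℝ (Fin p) →L[ℝ] EuclideanSpace ℝ (Fin p) => L v)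
      (Ring.mul_inverse_cancel _ hu)
  have hφ' := hφ.hasStrictFDerivAt_gradient.hasFDerivAt
  have hf' := hf.hasStrictFDerivAt_gradient.hasFDerivAt
  refine ⟨fun v => ?_, fun v => ?_, fun u v => ?_⟩
  · have := inner_hessian_le_of_inner_gradient_le hX hx hφ' hf' (a := 1) (b := -m)
      (fun x₁ h₁ x₂ h₂ => by linarith [hlower x₁ h₁ x₂ h₂]) (Ring.inverse (hessian φ x) v)
    rw [hinv] at this
    rw [mul_apply_eq_comp]
    linarith
  · have := inner_hessian_le_of_inner_gradient_le hX hx hφ' hf' (a := -1) (b := M)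
      (fun x₁ h₁ x₂ h₂ => by linarith [hupper x₁ h₁ x₂ h₂]) (Ring.inverse (hessian φ x) v)
    rw [hinv] at this
    rw [mul_apply_eq_comp]
    linarith
  · have hsymm : inner ℝ (hessian f x (Ring.inverse (hessian φ x) v)) u
        = inner ℝ (Ring.inverse (hessian φ x) (hessian f x u)) v := by
      rw [← inner_hessian_comm hf, ← real_inner_comm]
      conv_rhs => rw [← hinv v, real_inner_comm, inner_hessian_comm hφ, hinv]
      exact real_inner_comm _ _
    have hle : inner ℝ ((Ring.inverse (hessian φ x) * hessian f x
        - hessian f x * Ring.inverse (hessian φ x)) u) (-v) ≤ δ * (‖u‖ * ‖v‖) := by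
      refine (real_inner_le_norm _ _).trans ?_
      rw [norm_neg, ← mul_assoc]
      gcongr
      exact ContinuousLinearMap.le_of_opNorm_le _ hδ u
    rw [mul_apply_eq_comp, mul_apply_eq_comp, hsymm]
    simp only [inner_neg_right, sub_apply, mul_apply_eq_comp,
      inner_sub_left] at hle
    linarith

/-! ### The main inequality. -/

theorem proposition2 {p : ℕ} (X : Set (EuclideanSpace ℝ (Fin p)))
    (hXopen : IsOpen X) (hXcontr : ContractibleSpace X)
    (φ f : EuclideanSpace ℝ (Fin p) → ℝ)
    (hφLegendre : IsLegendreOn X φ)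
    (hφ : ContDiffOn ℝ 3 φ X) (hf : ContDiffOn ℝ 3 f X)
    (δ : ℝ) (hδ : 0 ≤ δ) (hcomm : HessianCommutatorBound X φ f δ)
    (m M : ℝ) (hm : 0 ≤ m) (hmM : m ≤ M) (hM : 0 < M)
    (hlower : ∀ x₁ ∈ X, ∀ x₂ ∈ X,
      m * ‖gradient φ x₁ - gradient φ x₂‖ ^ 2 ≤
        inner ℝ (gradient f x₁ - gradient f x₂) (gradient φ x₁ - gradient φ x₂))
    (hupper : ∀ x₁ ∈ X, ∀ x₂ ∈ X,
      inner ℝ (gradient f x₁ - gradient f x₂) (gradient φ x₁ - gradient φ x₂) ≤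
        M * ‖gradient φ x₁ - gradient φ x₂‖ ^ 2) :
    ∀ x₁ ∈ X, ∀ x₂ ∈ X,
      inner ℝ (gradient f x₁ - gradient f x₂) (gradient φ x₁ - gradient φ x₂) ≥
        1 / (m + M) * ‖gradient f x₁ - gradient f x₂‖ ^ 2 +
          (4 * m * M - 4 * M * δ - δ ^ 2) / (4 * (m + M)) *
            ‖gradient φ x₁ - gradient φ x₂‖ ^ 2 := by
  intro x₁ hx₁ x₂ hx₂
  have hφ2 : ∀ x ∈ X, ContDiffAt ℝ 2 φ x := fun x hx =>
    (hφ.contDiffAt (hXopen.mem_nhds hx)).of_le (by norm_num)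
  have hf2 : ∀ x ∈ X, ContDiffAt ℝ 2 f x := fun x hx =>
    (hf.contDiffAt (hXopen.mem_nhds hx)).of_le (by norm_num)
  have hstrict : ∀ x ∈ X, HasStrictFDerivAt (gradient φ) (hessian φ x) x := fun x hx =>
    (hφ2 x hx).hasStrictFDerivAt_gradient
  have hunit : ∀ x ∈ X, IsUnit (hessian φ x) := fun x hx => (hcomm x hx).1
  have hinj := hφLegendre.injOn_gradient
  have hseg := hφLegendre.segment_subset_image_gradient
    (fun x hx => (hstrict x hx).continuousAt.continuousWithinAt)
    (isOpen_image_gradient hstrict hunit hXopen subset_rfl) hx₂ hx₁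
  set y : ℝ → EuclideanSpace ℝ (Fin p) :=
    fun t => AffineMap.lineMap (gradient φ x₂) (gradient φ x₁) t
  -- The curve in `X` from `x₂` to `x₁` that `∇φ` maps onto the straight segment `y`; its velocity
  -- is therefore `(D²φ)⁻¹` applied to a constant vector.
  set x : ℝ → EuclideanSpace ℝ (Fin p) := Function.invFunOn (gradient φ) X ∘ y
  have hxX : ∀ t ∈ Set.Icc (0 : ℝ) 1, x t ∈ X := fun t ht => Function.invFunOn_mem (hseg t ht)
  have hxy : ∀ t ∈ Set.Icc (0 : ℝ) 1, gradient φ (x t) = y t := fun t ht =>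
    Function.invFunOn_eq (hseg t ht)
  have hxd : ∀ t ∈ Set.Icc (0 : ℝ) 1,
      HasDerivAt x (Ring.inverse (hessian φ (x t)) (gradient φ x₁ - gradient φ x₂)) t := by
    intro t ht
    have h := hasFDerivAt_invFunOn_gradient hXopen hinj hstrict hunit (hxX t ht)
    rw [hxy t ht] at h
    exact h.comp_hasDerivAt t AffineMap.hasDerivAt_lineMap
  have hJ : ContinuousOn (fun t => hessian f (x t) * Ring.inverse (hessian φ (x t)))
      (Set.Icc 0 1) := by
    intro t ht
    have hxc := (hxd t ht).continuousAt
    have h1 : ContinuousAt (fun t => hessian f (x t)) t :=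
      (hf2 _ (hxX t ht)).continuousAt_hessian.comp hxc
    have h2 : ContinuousAt (fun t => hessian φ (x t)) t :=
      (hφ2 _ (hxX t ht)).continuousAt_hessian.comp hxc
    obtain ⟨u, hu⟩ := hunit _ (hxX t ht)
    have h3 : ContinuousAt Ring.inverse (hessian φ (x t)) := hu ▸ NormedRing.inverse_continuousAt u
    exact (h1.mul (ContinuousAt.comp (f := fun t => hessian φ (x t)) h3 h2)).continuousWithinAt
  -- The derivative of `∇f` along the curve is `D²f (D²φ)⁻¹` applied to the fixed increment of `∇φ`,
  -- as the mean value theorem requires.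
  obtain ⟨A, ⟨hA1, hA2, hA3⟩, hA⟩ := exists_mem_sub_eq_apply_of_hasDerivAt
    (convex_quadraticBoundSet (EuclideanSpace ℝ (Fin p)) m M δ) (isClosed_quadraticBoundSet _ m M δ)
    hJ (fun t ht => hessian_mul_inverse_mem_quadraticBoundSet hXopen hcomm hlower hupper (hxX t ht)
      (hφ2 _ (hxX t ht)) (hf2 _ (hxX t ht)))
    (v := gradient φ x₁ - gradient φ x₂) (g := fun t => gradient f (x t))
    (fun t ht => (hf2 _ (hxX t ht)).hasStrictFDerivAt_gradient.hasFDerivAt.comp_hasDerivAt t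
      (hxd t ht))
  have hx0 : x 0 = x₂ := hinj (hxX 0 (by simp)) hx₂ (by rw [hxy 0 (by simp)]; simp [y])
  have hx1 : x 1 = x₁ := hinj (hxX 1 (by simp)) hx₁ (by rw [hxy 1 (by simp)]; simp [y])
  simp only [hx0, hx1] at hA
  have key := A.norm_sq_add_le_mul_inner_of_skew_le hm hmM hδ hA1 hA2 hA3
    (gradient φ x₁ - gradient φ x₂)
  rw [← hA] at key
  have hmM' : 0 < m + M := by linarith
  have hne := hmM'.ne'
  have e : ∀ a b : ℝ, 1 / (m + M) * a + (4 * m * M - 4 * M * δ - δ ^ 2) / (4 * (m + M)) * b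
      = (a + (m * M - M * δ - δ ^ 2 / 4) * b) / (m + M) := by
    intro a b
    field_simp
  rwa [ge_iff_le, e, div_le_iff₀' hmM']
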